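/- Definable means definable with parameters unless stated otherwise. Let $M$ be an $L$-structure. A function $h=(\dim,\mu)$ assigning to every nonempty definable set $X\subseteq M^n$ ($n\ge 0$) a pair $h(X)=(\dim X,\mu(X))\in\mathbb N\times\mathbb R_{>0}$ witnesses that $M$ is MS-measurable if: (i) for each $L$-formula $\phi(\bar x,\bar y)$, the set of values $h(\phi(\bar x,\bar a))$, where $\bar a$ ranges over the tuples from $M$ with $\phi(\bar x,\bar a)$ nonempty, is finite, and for each $(k,r)$ the set of those $\bar a$ with $h(\phi(\bar x,\bar a))=(k,r)$ is definable without parameters; (ii) if $X$ is finite, then $h(X)=(0,|X|)$; (iii) if $X,Y\subseteq M^n$ are disjoint, nonempty and definable, then $\dim(X\cup Y)=\max\{\dim X,\dim Y\}$, and $\mu(X\cup Y)$ equals $\mu(X)+\mu(Y)$ if $\dim X=\dim Y$, $\mu(X)$ if $\dim X>\dim Y$, and $\mu(Y)$ if $\dim X<\dim Y$; (iv) if $f:X\to Y$ is a definable surjection between nonempty definable sets and $h(f^{-1}(\bar a))=(d,r)$ for all $\bar a\in Y$, then $h(X)=(\dim Y+d,\ \mu(Y)\,r)$. $M$ is strongly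 minimal if it is infinite and, in every elementary extension $N$ of $M$, every definable subset of $N$ is finite or cofinite. $RM$ denotes Morley rank (computed in elementary extensions). **Lemma 2.3.** Let $D$ be a strongly minimal structure, and let $h=(\dim,\mu)$ witness that $D$ is MS-measurable. Then $RM(X)$ is a natural number for every nonempty definable set $X\subseteq D^n$, $n\ge 0$, and there is an integer $k>0$ such that $\dim X=k\cdot RM(X)$ for all such $X$. In particular, for all nonempty definable sets $X\subseteq D^n$ and $Y\subseteq D^m$, $\dim X=\dim Y$ if and only if $RM(X)=RM(Y)$; and $(RM,\mu)$ also witnesses that $D$ is MS-measurable. -/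

import Mathlib

open FirstOrder

universe u v w

section

variable (L : FirstOrder.Language.{u, v})

/-- `φ(N, g)`: the subset of `Nⁿ` defined by `φ(x₁, …, xₙ)`, a formula with parameters in `M`, after
the parameters have been sent to `N` by `g`. For `g = id` it is the subset of `Mⁿ` defined by `φ`;
for an elementary embedding `g` it is the set that `φ` defines in the elementary extension `N`. -/
def formulaSet {L : FirstOrder.Language.{u, v}} {M N : Type w} [L.Structure N] {n : ℕ}
    (φ : L.Formula (M ⊕ Fin n)) (g : M → N) : Set (Fin n → N) :=
  {x | φ.Realize (Sum.elim g x)}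

/-- The structure `M` is strongly minimal: it is infinite, and in every elementary extension `N`
of `M` each subset of `N` that is definable with parameters is finite or cofinite.

It is no restriction to take the elementary extensions in the universe of `M`. Two symbols with the
same interpretation in `M` have the same interpretation in every elementary extension, so up to
repetition `L` has no more symbols than there are finitary relations and functions on `M`, and by
Löwenheim–Skolem a counterexample can be found in the universe of `M` if there is any. -/
def IsStronglyMinimal (M : Type w) [L.Structure M] : Prop :=
  Infinite M ∧
    ∀ (N : Type w) [L.Structure N], Nonempty (M ↪ₑ[L] N) →
      ∀ X : Set N, (Set.univ : Set N).Definable₁ L X → X.Finite ∨ Xᶜ.Finite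

/-- `MorleyRankGE L α M X` says `RM(X) ≥ α`, for `X` a subset of `Mⁿ` definable with parameters:
* `RM(X) ≥ 0` iff `X` is non-empty;
* `RM(X) ≥ α + 1` iff in some elementary extension `N` of `M`, the set defined in `N` by a formula
  that defines `X` has infinitely many pairwise disjoint subsets, definable with parameters
  in `N`, each of Morley rank `≥ α`; the choice of the formula `φ` does not matter,
  since formulas that are equivalent in `M` are equivalent in `N`;
* for a limit ordinal `α`, `RM(X) ≥ α` iff `RM(X) ≥ β` for all `β < α`.

As for strong minimality, it is no restriction that `N` lies in the universe of `M`. -/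
inductive MorleyRankGE :
    Ordinal.{w} → ∀ (M : Type w) [L.Structure M] {n : ℕ}, Set (Fin n → M) → Prop
  | zero (M : Type w) [L.Structure M] {n : ℕ} (X : Set (Fin n → M)) (hX : X.Nonempty) :
      MorleyRankGE 0 M X
  | succ (α : Ordinal.{w}) (M : Type w) [L.Structure M] {n : ℕ} (X : Set (Fin n → M))
      (φ : L.Formula (M ⊕ Fin n)) (hφ : X = formulaSet φ id)
      (N : Type w) [L.Structure N] (j : M ↪ₑ[L] N) (S : ℕ → Set (Fin n → N))
      (hdef : ∀ i, (Set.univ : Set N).Definable L (S i))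
      (hsub : ∀ i, S i ⊆ formulaSet φ j)
      (hdisj : Pairwise fun i i' => Disjoint (S i) (S i'))
      (hS : ∀ i, MorleyRankGE α N (S i)) :
      MorleyRankGE (α + 1) M X
  | limit (α : Ordinal.{w}) (hα : Order.IsSuccLimit α) (M : Type w) [L.Structure M] {n : ℕ}
      (X : Set (Fin n → M)) (hX : ∀ β < α, MorleyRankGE β M X) :
      MorleyRankGE α M X

/-- The Morley rank of a definable set `X ⊆ Mⁿ`: the supremum of the ordinals `α` with
`RM(X) ≥ α`. It is `⊥` (that is, `-∞`) for `X = ∅`, and `⊤` (that is, `∞`) if `RM(X) ≥ α` for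
every ordinal `α`. -/
noncomputable def morleyRank {M : Type w} [L.Structure M] {n : ℕ} (X : Set (Fin n → M)) :
    WithBot (WithTop Ordinal.{w}) :=
  sSup {r | ∃ α : Ordinal.{w}, MorleyRankGE L α M X ∧ r = ((α : WithTop Ordinal.{w}) :
    WithBot (WithTop Ordinal.{w}))}

/-- `h = (dim, μ)` witnesses that `M` is MS-measurable. Only the values of `dim` and `μ` on non-empty
sets that are definable with parameters matter; nothing is required of the other values. -/
structure IsMSMeasure {M : Type w} [L.Structure M]
    (dim : ∀ n : ℕ, Set (Fin n → M) → ℕ) (μ : ∀ n : ℕ, Set (Fin n → M) → ℝ) : Prop where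
  /-- `μ` takes positive values. -/
  pos : ∀ (n : ℕ) (X : Set (Fin n → M)), (Set.univ : Set M).Definable L X → X.Nonempty →
    0 < μ n X
  /-- For each formula `φ(x, y)` without parameters, `h(φ(x, a))` takes finitely many values. -/
  finite_values : ∀ (m n : ℕ) (φ : L.Formula (Fin m ⊕ Fin n)),
    {p : ℕ × ℝ | ∃ a : Fin m → M, {x : Fin n → M | φ.Realize (Sum.elim a x)}.Nonempty ∧
      p = (dim n {x | φ.Realize (Sum.elim a x)}, μ n {x | φ.Realize (Sum.elim a x)})}.Finite
  /-- For each `φ(x, y)` and `(k, r)`, the set of `a` with `h(φ(x, a)) = (k, r)` is definable without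
  parameters. -/
  definable_values : ∀ (m n : ℕ) (φ : L.Formula (Fin m ⊕ Fin n)) (k : ℕ) (r : ℝ),
    (∅ : Set M).Definable L
      {a : Fin m → M | {x : Fin n → M | φ.Realize (Sum.elim a x)}.Nonempty ∧
        dim n {x | φ.Realize (Sum.elim a x)} = k ∧ μ n {x | φ.Realize (Sum.elim a x)} = r}
  /-- If `X` is finite then `h(X) = (0, |X|)`. -/
  of_finite : ∀ (n : ℕ) (X : Set (Fin n → M)), X.Nonempty → X.Finite →
    dim n X = 0 ∧ μ n X = (X.ncard : ℝ)
  /-- Dimension and measure of a disjoint union. -/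
  union : ∀ (n : ℕ) (X Y : Set (Fin n → M)), (Set.univ : Set M).Definable L X →
    (Set.univ : Set M).Definable L Y → X.Nonempty → Y.Nonempty → Disjoint X Y →
    dim n (X ∪ Y) = max (dim n X) (dim n Y) ∧
    (dim n X = dim n Y → μ n (X ∪ Y) = μ n X + μ n Y) ∧
    (dim n Y < dim n X → μ n (X ∪ Y) = μ n X) ∧
    (dim n X < dim n Y → μ n (X ∪ Y) = μ n Y)
  /-- If `f : X → Y` is a definable surjection all of whose fibres `f⁻¹(b)`, `b ∈ Y`, satisfy
  `h(f⁻¹(b)) = (d, r)`, then `h(X) = (dim(Y) + d, μ(Y) r)`. Definability of `f` is definability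
  of its graph in `Mⁿ × Mᵐ`. The values of `f` outside `X` play no role. -/
  fibre : ∀ (n m : ℕ) (X : Set (Fin n → M)) (Y : Set (Fin m → M)),
    (Set.univ : Set M).Definable L X → (Set.univ : Set M).Definable L Y →
    X.Nonempty → Y.Nonempty →
    ∀ f : (Fin n → M) → (Fin m → M), f '' X = Y →
    (Set.univ : Set M).Definable L
      {z : Fin n ⊕ Fin m → M | z ∘ Sum.inl ∈ X ∧ f (z ∘ Sum.inl) = z ∘ Sum.inr} →
    ∀ (d : ℕ) (r : ℝ),
    (∀ b ∈ Y, dim n {x ∈ X | f x = b} = d ∧ μ n {x ∈ X | f x = b} = r) →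
    dim n X = dim m Y + d ∧ μ n X = μ m Y * r

end

namespace StronglyMinimal

open FirstOrder.Language

variable {L : FirstOrder.Language.{u, v}}

/-! ### Formulas and definable sets -/

/-! Both invariants are compared with a combinatorial one: the greatest length of a list `l` of
coordinates with `IsLarge l X`. Put `k = dim D`, which is positive because `D` is infinite.

On the measure side, `X` is cut into finitely many pieces over a coordinate on which the slices have
constant dimension and measure, and the dimension is additive on each piece (`exists_fibration`). An
infinite definable subset of the line is cofinite, so it has dimension `k`; a nonempty finite one
has dimension `0`. Induction on coordinates then shows that `IsLarge l X` forces `dim X ≥ k *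
l.length` (`mul_length_le_dim`), and that some large `l` attains equality (`exists_isLarge_dim_eq`).

On the rank side, slices along a large list are infinitely many disjoint sets witnessing `RM(X) ≥
l.length` (`IsLarge.morleyRankGE`). The converse has to work in elementary extensions, which carry
no measure. What survives there is uniform minimality: `μ` counts finite sets and takes finitely
many values on a family, so the finite members of a family are bounded in size, and this passes to
every structure elementarily equivalent to `D`. Hence "infinitely many", and so largeness, is
first-order, and `RM(X) ≥ m` yields a large list of length `m` (`exists_isLarge_of_morleyRankGE`).
-/

lemma formulaSet_not {M N : Type w} [L.Structure N] {n : ℕ} (φ : L.Formula (M ⊕ Fin n))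
    (g : M → N) : formulaSet φ.not g = (formulaSet φ g)ᶜ := by
  ext x
  simp [formulaSet]

lemma exists_formulaSet_eq {N : Type w} [L.Structure N] {n : ℕ} {X : Set (Fin n → N)}
    (hX : (Set.univ : Set N).Definable L X) : ∃ φ : L.Formula (N ⊕ Fin n), X = formulaSet φ id := by
  obtain ⟨φ, rfl⟩ := Set.definable_iff_exists_formula_sum.1 hX
  refine ⟨φ.relabel (Sum.map Subtype.val id), ?_⟩
  ext x
  simp only [formulaSet, Set.mem_ofPred_eq, Formula.realize_relabel, Sum.elim_comp_map]
  rfl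

lemma definable_formulaSet {M N : Type w} [L.Structure N] {n : ℕ} (φ : L.Formula (M ⊕ Fin n))
    (g : M → N) : (Set.univ : Set N).Definable L (formulaSet φ g) := by
  refine Set.definable_iff_exists_formula_sum.2
    ⟨φ.relabel (Sum.map (fun a => ⟨g a, Set.mem_univ _⟩) id), ?_⟩
  ext x
  simp only [formulaSet, Set.mem_ofPred_eq, Formula.realize_relabel, Sum.elim_comp_map]
  rfl

lemma definable_singleton {N : Type w} [L.Structure N] {n : ℕ} (c : Fin n → N) :
    (Set.univ : Set N).Definable L {c} := by
  have : ({c} : Set (Fin n → N)) = ⋂ i : Fin n, (fun x : Fin n → N => x ∘ fun _ : Fin 1 => i) ⁻¹'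
      {x : Fin 1 → N | x 0 ∈ ({c i} : Set N)} := by
    ext x
    simp [funext_iff]
  rw [this]
  exact Set.definable_iInter_of_finite fun i =>
    (Set.Definable.singleton_of_mem L (Set.mem_univ (c i))).preimage_comp _

lemma definable_finset {N : Type w} [L.Structure N] {n : ℕ} (F : Finset (Fin n → N)) :
    (Set.univ : Set N).Definable L (F : Set (Fin n → N)) := by
  rw [← Set.biUnion_of_singleton (F : Set (Fin n → N))]
  exact Set.definable_biUnion_finset (fun c => definable_singleton c) F

/-- A formula has only finitely many free variables. -/
lemma exists_formula_fin_left {α β : Type*} (φ : L.Formula (α ⊕ β)) :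
    ∃ (m : ℕ) (e : Fin m → α) (φ' : L.Formula (Fin m ⊕ β)),
      ∀ (N : Type w) [L.Structure N] (a : α → N) (x : β → N),
        φ'.Realize (Sum.elim (a ∘ e) x) ↔ φ.Realize (Sum.elim a x) := by
  classical
  let s := BoundedFormula.freeVarFinset φ
  let t := s.toLeft
  refine ⟨t.card, fun i => (t.equivFin.symm i : α), BoundedFormula.restrictFreeVar φ fun z =>
    match z with
    | ⟨Sum.inl y, hy⟩ => Sum.inl (t.equivFin ⟨y, Finset.mem_toLeft.2 hy⟩)
    | ⟨Sum.inr y, _⟩ => Sum.inr y, fun N _ a x => ?_⟩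
  refine BoundedFormula.realize_restrictFreeVar (Sum.elim a x) ?_
  rintro ⟨y | y, hy⟩ <;> simp

lemma natCast_le_encard_iff {β : Type*} {S : Set β} {B : ℕ} :
    (B : ℕ∞) ≤ S.encard ↔ ∃ f : Fin B → β, Function.Injective f ∧ ∀ i, f i ∈ S := by
  constructor
  · intro h
    obtain ⟨t, hts, ht⟩ := Set.exists_subset_encard_eq h
    have htf : t.Finite := Set.finite_of_encard_eq_coe ht
    have hc : htf.toFinset.card = B := by
      rw [htf.encard_eq_coe_toFinset_card] at ht
      exact_mod_cast ht
    refine ⟨fun i => ((htf.toFinset.equivFinOfCardEq hc).symm i : β), ?_, fun i => hts ?_⟩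
    · exact Subtype.val_injective.comp (Equiv.injective _)
    · exact htf.mem_toFinset.1 (Subtype.prop _)
  · rintro ⟨f, hf, hS⟩
    calc (B : ℕ∞) = (Set.range f).encard := by
          rw [← Set.image_univ, hf.encard_image, Set.encard_univ]; simp
      _ ≤ S.encard := Set.encard_le_encard (Set.range_subset_iff.2 hS)

/-- "At least `B` elements satisfy `φ(a, ·)`" is expressed by a formula in `a`. -/
lemma exists_formula_le_encard {α : Type w} (φ : L.Formula (α ⊕ Fin 1)) (B : ℕ) :
    ∃ ψ : L.Formula α, ∀ (N : Type w) [L.Structure N] (a : α → N),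
      ψ.Realize a ↔ (B : ℕ∞) ≤ (formulaSet φ a).encard := by
  refine ⟨Formula.iExs (Fin B)
    (Formula.iInf (fun i : Fin B => φ.relabel (Sum.map id fun _ => i)) ⊓
      Formula.iInf (fun p : {p : Fin B × Fin B // p.1 ≠ p.2} =>
        (Term.equal (Term.var (Sum.inr p.1.1)) (Term.var (Sum.inr p.1.2))).not)), ?_⟩
  intro N _ a
  rw [natCast_le_encard_iff, Formula.realize_iExs]
  simp only [Formula.realize_inf, Formula.realize_iInf, Formula.realize_relabel,
    Formula.realize_not, Formula.realize_equal, Term.realize_var, Sum.elim_inr,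
    Sum.elim_comp_map, Function.comp_id, formulaSet, Set.mem_ofPred_eq]
  constructor
  · rintro ⟨v, h1, h2⟩
    refine ⟨fun i _ => v i, fun i i' hi => ?_, h1⟩
    by_contra hne
    exact h2 ⟨(i, i'), hne⟩ (congrFun hi 0)
  · rintro ⟨f, hf, hS⟩
    refine ⟨fun i => f i 0, fun i => ?_, fun p hp => p.2 (hf ?_)⟩
    · have : f i = (fun i => f i 0) ∘ fun _ : Fin 1 => i := by
        ext k
        rw [Subsingleton.elim k 0]; rfl
      rw [← this]
      exact hS i
    · ext k
      rw [Subsingleton.elim k 0]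
      exact hp

/-! ### Slices and large sets -/

/-- The points of `X` whose `j`-th coordinate is `a`. -/
def slice {N : Type w} {n : ℕ} (X : Set (Fin n → N)) (j : Fin n) (a : Fin 1 → N) :
    Set (Fin n → N) :=
  {x ∈ X | (fun _ => x j) = a}

/-- `IsLarge [j₁, …, jₘ] X` says that for infinitely many `a₁`, …, for infinitely many `aₘ`, there
is a point of `X` whose coordinates at `j₁, …, jₘ` are `a₁, …, aₘ`. -/
def IsLarge {N : Type w} {n : ℕ} : List (Fin n) → Set (Fin n → N) → Prop
  | [], X => X.Nonempty
  | j :: l, X => {a | IsLarge l (slice X j a)}.Infinite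

lemma slice_subset {N : Type w} {n : ℕ} (X : Set (Fin n → N)) (j : Fin n) (a : Fin 1 → N) :
    slice X j a ⊆ X :=
  fun _ hx => hx.1

lemma slice_mono {N : Type w} {n : ℕ} {X Y : Set (Fin n → N)} (h : X ⊆ Y) (j : Fin n)
    (a : Fin 1 → N) : slice X j a ⊆ slice Y j a :=
  fun _ hx => ⟨h hx.1, hx.2⟩

lemma disjoint_slice {N : Type w} {n : ℕ} (X : Set (Fin n → N)) (j : Fin n) {a b : Fin 1 → N}
    (h : a ≠ b) : Disjoint (slice X j a) (slice X j b) :=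
  Set.disjoint_left.2 fun _ hx hy => h (hx.2.symm.trans hy.2)

lemma IsLarge.mono {N : Type w} {n : ℕ} {l : List (Fin n)} {X Y : Set (Fin n → N)}
    (hX : IsLarge l X) (h : X ⊆ Y) : IsLarge l Y := by
  induction l generalizing X Y with
  | nil => exact Set.Nonempty.mono h hX
  | cons j l ih => exact Set.Infinite.mono (fun a ha => ih ha (slice_mono h j a)) hX

lemma IsLarge.nonempty {N : Type w} {n : ℕ} {l : List (Fin n)} {X : Set (Fin n → N)}
    (hX : IsLarge l X) : X.Nonempty := by
  induction l generalizing X with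
  | nil => exact hX
  | cons j l ih =>
    obtain ⟨a, ha⟩ := Set.Infinite.nonempty hX
    exact (ih ha).mono (slice_subset X j a)

/-- The formula for the slices of the sets defined by `φ`. -/
noncomputable def sliceFormula {α : Type w} {n : ℕ} (φ : L.Formula (α ⊕ Fin n)) (j : Fin n) :
    L.Formula ((α ⊕ Fin 1) ⊕ Fin n) :=
  φ.relabel (Sum.map Sum.inl id) ⊓
    Term.equal (Term.var (Sum.inr j)) (Term.var (Sum.inl (Sum.inr 0)))

lemma formulaSet_sliceFormula {α N : Type w} [L.Structure N] {n : ℕ} (φ : L.Formula (α ⊕ Fin n))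
    (j : Fin n) (a : α → N) (b : Fin 1 → N) :
    formulaSet (sliceFormula φ j) (Sum.elim a b) = slice (formulaSet φ a) j b := by
  ext x
  simp [formulaSet, sliceFormula, slice, Sum.elim_comp_map, funext_iff]

lemma definable_slice {N : Type w} [L.Structure N] {n : ℕ} {X : Set (Fin n → N)}
    (hX : (Set.univ : Set N).Definable L X) (j : Fin n) (b : Fin 1 → N) :
    (Set.univ : Set N).Definable L (slice X j b) := by
  obtain ⟨φ, rfl⟩ := exists_formulaSet_eq hX
  rw [← formulaSet_sliceFormula]
  exact definable_formulaSet _ _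

/-- Large definable sets have large Morley rank. -/
lemma IsLarge.morleyRankGE {N : Type w} [L.Structure N] {n : ℕ} {l : List (Fin n)}
    {X : Set (Fin n → N)} (hX : IsLarge l X) (hdef : (Set.univ : Set N).Definable L X) :
    MorleyRankGE L (l.length : Ordinal.{w}) N X := by
  induction l generalizing X with
  | nil => simpa using MorleyRankGE.zero N X hX
  | cons j l ih =>
    obtain ⟨φ, hφ⟩ := exists_formulaSet_eq hdef
    have hinf : {a | IsLarge l (slice X j a)}.Infinite := hX
    let a := Set.Infinite.natEmbedding _ hinf
    -- The slices over infinitely many `a` are the disjoint subsets; no proper elementary extension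
    -- is needed.
    have := MorleyRankGE.succ (l.length : Ordinal.{w}) N X φ hφ N
      (ElementaryEmbedding.refl L N) (fun i => slice X j (a i))
      (fun i => definable_slice hdef j _) (fun i => (slice_subset X j _).trans hφ.subset)
      (fun i i' hi => disjoint_slice X j fun h => hi (a.injective (Subtype.ext h)))
      (fun i => ih (a i).2 (definable_slice hdef j _))
    simpa using this

/-! ### Uniformly minimal structures -/

variable (L) in
/-- `D` is infinite, and in all structures elementarily equivalent to `D` the definable families of
subsets of the line are uniformly finite or cofinite. -/
def UniformlyMinimal (D : Type w) [L.Structure D] : Prop :=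
  Infinite D ∧ ∀ (α : Type w) (φ : L.Formula (α ⊕ Fin 1)), ∃ B : ℕ,
    ∀ (N : Type w) [L.Structure N], (D ≅[L] N) → ∀ a : α → N,
      (formulaSet φ a).encard ≤ B ∨ (formulaSet φ a)ᶜ.encard ≤ B

variable {D : Type w} [L.Structure D]

/-- A finite member of the family has at most `B` elements, so "infinite" means the same as "at
least `B + 1` elements", which is first-order. -/
lemma UniformlyMinimal.exists_formula_infinite (hD : UniformlyMinimal L D) {α : Type w}
    (φ : L.Formula (α ⊕ Fin 1)) : ∃ (B : ℕ) (ψ : L.Formula α),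
      ∀ (N : Type w) [L.Structure N], (D ≅[L] N) → ∀ a : α → N,
        (ψ.Realize a ↔ (formulaSet φ a).Infinite) ∧
        ((formulaSet φ a).Finite → (formulaSet φ a).encard ≤ B) := by
  obtain ⟨B, hB⟩ := hD.2 α φ
  obtain ⟨ψ, hψ⟩ := exists_formula_le_encard φ (B + 1)
  refine ⟨B, ψ, fun N _ hN a => ?_⟩
  have := hD.1
  have : Infinite N := hN.infinite
  have key : (formulaSet φ a).Finite → (formulaSet φ a).encard ≤ B := fun hfin =>
    (hB N hN a).resolve_right fun hc =>
      hfin.infinite_compl (Set.finite_of_encard_le_coe hc)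
  refine ⟨?_, key⟩
  rw [hψ]
  constructor
  · intro h hfin
    have := h.trans (key hfin)
    norm_cast at this
    omega
  · intro h
    simp [h.encard_eq]

lemma UniformlyMinimal.finite_or_finite_compl (hD : UniformlyMinimal L D) {N : Type w}
    [L.Structure N] (hN : D ≅[L] N) {S : Set (Fin 1 → N)}
    (hS : (Set.univ : Set N).Definable L S) : S.Finite ∨ Sᶜ.Finite := by
  obtain ⟨φ, rfl⟩ := exists_formulaSet_eq hS
  obtain ⟨B, hB⟩ := hD.2 N φ
  exact (hB N hN id).imp Set.finite_of_encard_le_coe Set.finite_of_encard_le_coe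

lemma UniformlyMinimal.exists_formula_isLarge (hD : UniformlyMinimal L D) {n : ℕ}
    (l : List (Fin n)) {α : Type w} (φ : L.Formula (α ⊕ Fin n)) : ∃ ψ : L.Formula α,
      ∀ (N : Type w) [L.Structure N], (D ≅[L] N) → ∀ a : α → N,
        ψ.Realize a ↔ IsLarge l (formulaSet φ a) := by
  induction l generalizing α with
  | nil => exact ⟨φ.iExs (Fin n), fun N _ _ a => Formula.realize_iExs⟩
  | cons j l ih =>
    obtain ⟨θ, hθ⟩ := ih (sliceFormula φ j)
    obtain ⟨_, ψ, hψ⟩ := hD.exists_formula_infinite θ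
    refine ⟨ψ, fun N _ hN a => ?_⟩
    have : formulaSet θ a = {b | IsLarge l (slice (formulaSet φ a) j b)} := by
      ext b
      rw [Set.mem_ofPred_eq, ← formulaSet_sliceFormula]
      exact hθ N hN _
    rw [(hψ N hN a).1, this]
    rfl

lemma UniformlyMinimal.definable_isLarge_slice (hD : UniformlyMinimal L D) {N : Type w}
    [L.Structure N] (hN : D ≅[L] N) {n : ℕ} {X : Set (Fin n → N)}
    (hX : (Set.univ : Set N).Definable L X) (l : List (Fin n)) (j : Fin n) :
    (Set.univ : Set N).Definable L {b | IsLarge l (slice X j b)} := by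
  obtain ⟨φ, rfl⟩ := exists_formulaSet_eq hX
  obtain ⟨ψ, hψ⟩ := hD.exists_formula_isLarge l (sliceFormula φ j)
  convert definable_formulaSet ψ (id : N → N) using 1
  ext b
  rw [Set.mem_ofPred_eq, ← formulaSet_sliceFormula]
  exact (hψ N hN _).symm

lemma exists_formula_slice_nonempty {n : ℕ} {α : Type w}
    (φ : L.Formula (α ⊕ Fin n)) (j : Fin n) : ∃ θ : L.Formula (α ⊕ Fin 1),
      ∀ (N : Type w) [L.Structure N] (a : α → N),
        formulaSet θ a = {b | (slice (formulaSet φ a) j b).Nonempty} := by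
  refine ⟨(sliceFormula φ j).iExs (Fin n), fun N _ a => ?_⟩
  ext b
  rw [Set.mem_ofPred_eq, ← formulaSet_sliceFormula]
  exact Formula.realize_iExs

/-- Sufficiently many disjoint large subsets make a set larger. -/
lemma UniformlyMinimal.exists_isLarge_append (hD : UniformlyMinimal L D) {n : ℕ}
    (l : List (Fin n)) {α : Type w} (φ : L.Formula (α ⊕ Fin n)) : ∃ K : ℕ,
      ∀ (N : Type w) [L.Structure N], (D ≅[L] N) → ∀ (a : α → N) (S : Fin K → Set (Fin n → N)),
        (∀ i, (Set.univ : Set N).Definable L (S i)) → (∀ i, S i ⊆ formulaSet φ a) →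
        (Pairwise fun i i' => Disjoint (S i) (S i')) → (∀ i, IsLarge l (S i)) →
        ∃ j, IsLarge (l ++ [j]) (formulaSet φ a) := by
  induction l generalizing α with
  | nil =>
    choose θ hθ using exists_formula_slice_nonempty φ
    choose B _ hB using fun j => hD.exists_formula_infinite (θ j)
    -- If every coordinate projection is finite, the `j`-th has at most `B j` points, so the whole
    -- set has at most `∏ j, B j` points, too few for one in each `S i`.
    refine ⟨∏ j, B j + 1, fun N _ hN a S _ hS hdisj hne => ?_⟩
    by_contra! hsmall
    have hfin : ∀ j, {b | (slice (formulaSet φ a) j b).Nonempty}.Finite := fun j =>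
      Set.not_infinite.1 (hsmall j)
    choose x hx using hne
    let T : Finset (Fin n → Fin 1 → N) := Fintype.piFinset fun j => (hfin j).toFinset
    have hcard : T.card ≤ ∏ j, B j := by
      rw [Fintype.card_piFinset]
      refine Finset.prod_le_prod' fun j _ => ?_
      have h := (hB j N hN a).2
      rw [hθ] at h
      have h := h (hfin j)
      rw [(hfin j).encard_eq_coe_toFinset_card] at h
      exact_mod_cast h
    have hmaps : ∀ i ∈ (Finset.univ : Finset (Fin (∏ j, B j + 1))),
        (fun j (_ : Fin 1) => x i j) ∈ T := by
      intro i _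
      rw [Fintype.mem_piFinset]
      intro j
      rw [Set.Finite.mem_toFinset]
      exact ⟨x i, hS i (hx i), rfl⟩
    obtain ⟨i, -, i', -, hne, heq⟩ := Finset.exists_ne_map_eq_of_card_lt_of_maps_to
      (by rw [Finset.card_univ, Fintype.card_fin]; omega) hmaps
    refine Set.disjoint_left.1 (hdisj hne) (hx i) ?_
    have : x i = x i' := by
      ext j
      exact congrFun (congrFun heq j) 0
    rw [this]
    exact hx i'
  | cons j l ih =>
    -- The slice point `b` becomes an extra parameter here; this is why `K` must not depend on
    -- parameters.
    obtain ⟨K, hK⟩ := ih (sliceFormula φ j)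
    refine ⟨K, fun N _ hN a S hdef hS hdisj hl => ?_⟩
    have := hD.1
    have : Infinite N := hN.infinite
    have hcof : ∀ i, {b | IsLarge l (slice (S i) j b)}ᶜ.Finite := fun i =>
      (hD.finite_or_finite_compl hN (hD.definable_isLarge_slice hN (hdef i) l j)).resolve_left
        (hl i)
    -- Each of the finitely many sets is infinite, hence cofinite, so infinitely many `b` serve all
    -- `S i` at once. The last coordinate `j'` found for `b` is then fixed by pigeonhole.
    have hinf : (⋂ i, {b | IsLarge l (slice (S i) j b)}).Infinite := by
      have hc := (Set.finite_iUnion hcof).infinite_compl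
      simpa [Set.compl_iUnion] using hc
    have hsub : (⋂ i, {b | IsLarge l (slice (S i) j b)}) ⊆
        ⋃ j', {b | IsLarge (l ++ [j']) (slice (formulaSet φ a) j b)} := by
      intro b hb
      rw [Set.mem_iInter] at hb
      have h := hK N hN (Sum.elim a b) (fun i => slice (S i) j b)
        (fun i => definable_slice (hdef i) j b)
        (fun i => by rw [formulaSet_sliceFormula]; exact slice_mono (hS i) j b)
        (fun i i' hi => (hdisj hi).mono (slice_subset _ _ _) (slice_subset _ _ _)) hb
      rw [formulaSet_sliceFormula] at h
      exact Set.mem_iUnion.2 h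
    by_contra! hsmall
    exact (hinf.mono hsub) (Set.finite_iUnion fun j' => Set.not_infinite.1 (hsmall j'))

/-- There are finitely many lists of length `m`, so infinitely many of the `S i` share one list
`l₀`; the first `K` of these suffice to extend it by a coordinate. -/
lemma UniformlyMinimal.exists_isLarge_of_disjoint (hD : UniformlyMinimal L D) {N : Type w}
    [L.Structure N] (hN : D ≅[L] N) {n m : ℕ} {X : Set (Fin n → N)}
    (hX : (Set.univ : Set N).Definable L X) (S : ℕ → Set (Fin n → N))
    (hdef : ∀ i, (Set.univ : Set N).Definable L (S i)) (hS : ∀ i, S i ⊆ X)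
    (hdisj : Pairwise fun i i' => Disjoint (S i) (S i'))
    (hl : ∀ i, ∃ l : List (Fin n), l.length = m ∧ IsLarge l (S i)) :
    ∃ l : List (Fin n), l.length = m + 1 ∧ IsLarge l X := by
  choose l hlen hl using hl
  have : Finite {l : List (Fin n) // l.length = m} := inferInstanceAs (Finite (List.Vector _ _))
  obtain ⟨⟨l₀, hl₀⟩, hinf⟩ := Finite.exists_infinite_fiber
    fun i => (⟨l i, hlen i⟩ : {l : List (Fin n) // l.length = m})
  obtain ⟨φ, rfl⟩ := exists_formulaSet_eq hX
  obtain ⟨K, hK⟩ := hD.exists_isLarge_append l₀ φ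
  let e : Fin K → ℕ := fun i => (Infinite.natEmbedding _ i.1 :
    (fun i => (⟨l i, hlen i⟩ : {l : List (Fin n) // l.length = m})) ⁻¹' {⟨l₀, hl₀⟩})
  have he : Function.Injective e := fun i i' h =>
    Fin.ext ((Infinite.natEmbedding _).injective (Subtype.ext h))
  have hel : ∀ i, l (e i) = l₀ := fun i => congrArg Subtype.val
    (Subtype.prop (Infinite.natEmbedding
      ((fun i => (⟨l i, hlen i⟩ : {l : List (Fin n) // l.length = m})) ⁻¹' {⟨l₀, hl₀⟩}) i.1))
  obtain ⟨j, hj⟩ := hK N hN id (S ∘ e) (fun i => hdef _) (fun i => hS _)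
    (fun i i' hi => hdisj (he.ne hi)) (fun i => by rw [← hel i]; exact hl _)
  exact ⟨l₀ ++ [j], by simp [hl₀], hj⟩

/-- Lets the successor step for Morley rank be carried out in the extension `N` and brought back to
`M`. -/
lemma UniformlyMinimal.isLarge_formulaSet_iff (hD : UniformlyMinimal L D) {M N : Type w}
    [L.Structure M] [L.Structure N] (hM : D ≅[L] M) (j : M ↪ₑ[L] N) {n : ℕ}
    (φ : L.Formula (M ⊕ Fin n)) (l : List (Fin n)) :
    IsLarge l (formulaSet φ j) ↔ IsLarge l (formulaSet φ id) := by
  obtain ⟨ψ, hψ⟩ := hD.exists_formula_isLarge l φ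
  rw [← hψ N (hM.trans j.elementarilyEquivalent), ← hψ M hM, ← j.map_formula]
  rfl

/-- Definable sets of large Morley rank are large. -/
lemma UniformlyMinimal.exists_isLarge_of_morleyRankGE (hD : UniformlyMinimal L D)
    {α : Ordinal.{w}} {N : Type w} [L.Structure N] {n : ℕ} {X : Set (Fin n → N)}
    (hα : MorleyRankGE L α N X) (hN : D ≅[L] N) (hX : (Set.univ : Set N).Definable L X)
    {m : ℕ} (hm : (m : Ordinal.{w}) ≤ α) :
    ∃ l : List (Fin n), l.length = m ∧ IsLarge l X := by
  induction hα generalizing m with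
  | zero M X hne =>
    obtain rfl : m = 0 := by simpa using hm
    exact ⟨[], rfl, hne⟩
  | @succ α M _ n X φ hφ N _ j S hdef hsub hdisj hS ih =>
    have hN' := hN.trans j.elementarilyEquivalent
    subst hφ
    simp only [← hD.isLarge_formulaSet_iff hN j φ]
    cases m with
    | zero =>
      obtain ⟨l, -, hl⟩ := ih 0 hN' (hdef 0) (m := 0) (by simp)
      exact ⟨[], rfl, hl.nonempty.mono (hsub 0)⟩
    | succ m =>
      have hm' : (m : Ordinal.{w}) ≤ α := by
        rw [Nat.cast_succ] at hm
        simpa [← Order.succ_eq_add_one] using hm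
      exact hD.exists_isLarge_of_disjoint hN' (definable_formulaSet φ j) S hdef hsub hdisj
        fun i => ih i hN' (hdef i) hm'
  | limit α hlim M X _ ih =>
    -- Only finite `m` matter, and a limit ordinal exceeds them all.
    have hlt : (m : Ordinal.{w}) < α := Ordinal.natCast_lt_of_isSuccLimit hlim m
    exact ih m hlt hN hX le_rfl

/-! ### MS-measurable strongly minimal structures -/

lemma _root_.IsStronglyMinimal.finite_or_finite_compl (hD : IsStronglyMinimal L D)
    {S : Set (Fin 1 → D)} (hS : (Set.univ : Set D).Definable L S) : S.Finite ∨ Sᶜ.Finite := by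
  let e : D ≃ (Fin 1 → D) := (Equiv.funUnique (Fin 1) D).symm
  have hdef : (Set.univ : Set D).Definable₁ L (e ⁻¹' S) := by
    have : {x : Fin 1 → D | x 0 ∈ e ⁻¹' S} = S := by
      ext x
      have : e (x 0) = x := by
        ext k
        rw [Subsingleton.elim k 0]; rfl
      simp [this]
    rwa [Set.Definable₁, this]
  have hfin : ∀ T : Set (Fin 1 → D), (e ⁻¹' T).Finite → T.Finite := fun T hT => by
    rw [← e.image_preimage T]
    exact hT.image e
  exact (hD.2 D ⟨ElementaryEmbedding.refl L D⟩ _ hdef).imp (hfin S) (hfin Sᶜ)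

variable {dim : ∀ n : ℕ, Set (Fin n → D) → ℕ} {μ : ∀ n : ℕ, Set (Fin n → D) → ℝ}

/-- The finite members of a definable family have boundedly many elements. -/
lemma _root_.IsMSMeasure.exists_encard_le (h : IsMSMeasure L dim μ) {m n : ℕ}
    (φ : L.Formula (Fin m ⊕ Fin n)) : ∃ B : ℕ, ∀ a : Fin m → D,
      {x : Fin n → D | φ.Realize (Sum.elim a x)}.Finite →
      {x : Fin n → D | φ.Realize (Sum.elim a x)}.encard ≤ B := by
  obtain ⟨b, hb⟩ := ((h.finite_values m n φ).image Prod.snd).bddAbove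
  obtain ⟨B, hB⟩ := exists_nat_ge b
  refine ⟨B, fun a hfin => ?_⟩
  obtain hemp | hne := Set.eq_empty_or_nonempty {x : Fin n → D | φ.Realize (Sum.elim a x)}
  · simp [hemp]
  · have hle := hb ⟨_, ⟨a, hne, rfl⟩, rfl⟩
    rw [← hfin.cast_ncard_eq]
    -- On finite sets `μ` is the cardinality, so a bound for the finitely many values of `μ` bounds
    -- the sizes.
    simp only [(h.of_finite n _ hne hfin).2] at hle
    exact_mod_cast hle.trans hB

/-- In `D` the bound comes from the measure, applied to the family and to its complements. A single
sentence states that it fails, so its falsity transfers to every `N` elementarily equivalent to `D`.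
-/
lemma _root_.IsMSMeasure.uniformlyMinimal (h : IsMSMeasure L dim μ)
    (hD : IsStronglyMinimal L D) : UniformlyMinimal L D := by
  refine ⟨hD.1, fun α φ => ?_⟩
  obtain ⟨m, e, φ', hφ'⟩ := exists_formula_fin_left.{u, v, w} φ
  obtain ⟨B₁, hB₁⟩ := h.exists_encard_le φ'
  obtain ⟨B₂, hB₂⟩ := h.exists_encard_le φ'.not
  let ι := ULift.{w} (Fin m)
  let φ'' : L.Formula (ι ⊕ Fin 1) := φ'.relabel (Sum.map ULift.up id)
  have hφ'' : ∀ (N : Type w) [L.Structure N] (a : ι → N),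
      formulaSet φ'' a = {x | φ'.Realize (Sum.elim (a ∘ ULift.up) x)} := fun N _ a => by
    ext x
    simp [formulaSet, φ'', Sum.elim_comp_map]
  let B := max B₁ B₂
  obtain ⟨ψ₁, hψ₁⟩ := exists_formula_le_encard φ'' (B + 1)
  obtain ⟨ψ₂, hψ₂⟩ := exists_formula_le_encard φ''.not (B + 1)
  have hlt : ∀ c : ℕ∞, ((B + 1 : ℕ) : ℕ∞) ≤ c ↔ ¬ c ≤ B := fun c => by
    rw [not_le, Nat.cast_succ, ENat.add_one_le_iff (ENat.natCast_ne_top B)]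
  -- `σ` says that for some parameters both the set and its complement have more than `B` elements.
  let σ : L.Sentence := Formula.iExs ι ((ψ₁ ⊓ ψ₂).relabel Sum.inr)
  have hσ : ∀ (N : Type w) [L.Structure N], N ⊨ σ ↔
      ∃ a : ι → N, ψ₁.Realize a ∧ ψ₂.Realize a := fun N _ => by
    simp only [Sentence.Realize, σ, Formula.realize_iExs, Formula.realize_relabel,
      Formula.realize_inf, Sum.elim_comp_inr]
  have hnot : ¬ D ⊨ σ := by
    rw [hσ]
    rintro ⟨a, h₁, h₂⟩
    rw [hψ₁, hlt, hφ''] at h₁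
    rw [hψ₂, hlt, formulaSet_not, hφ''] at h₂
    obtain hf | hf := hD.finite_or_finite_compl (hφ'' D a ▸ definable_formulaSet φ'' a)
    · exact h₁ ((hB₁ _ hf).trans (by simp [B]))
    · refine h₂ (le_trans ?_ (show (B₂ : ℕ∞) ≤ B by simp [B]))
      simpa [Set.compl_ofPred] using hB₂ (a ∘ ULift.up) (by simpa [Set.compl_ofPred] using hf)
  refine ⟨B, fun N _ hN a => ?_⟩
  have hnot' : ¬ N ⊨ σ := fun hs => hnot ((elementarilyEquivalent_iff.1 hN σ).2 hs)
  have heq : formulaSet φ a = formulaSet φ'' (fun i => a (e i.down)) := by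
    rw [hφ'']
    ext x
    exact (hφ' N a x).symm
  by_contra! hc
  refine hnot' ((hσ N).2 ⟨fun i => a (e i.down), ?_, ?_⟩)
  · rw [hψ₁, hlt, ← heq, not_le]
    exact hc.1
  · rw [hψ₂, hlt, formulaSet_not, ← heq, not_le]
    exact hc.2

/-! ### Elementary properties of the dimension -/

lemma _root_.IsMSMeasure.dim_mono (h : IsMSMeasure L dim μ) {n : ℕ} {X Y : Set (Fin n → D)}
    (hX : (Set.univ : Set D).Definable L X) (hY : (Set.univ : Set D).Definable L Y)
    (hne : X.Nonempty) (hXY : X ⊆ Y) : dim n X ≤ dim n Y := by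
  obtain hemp | hne' := Set.eq_empty_or_nonempty (Y \ X)
  · rw [Set.Subset.antisymm hXY (Set.sdiff_eq_empty.1 hemp)]
  · have := (h.union n X (Y \ X) hX (hY.sdiff hX) hne hne' Set.disjoint_sdiff_right).1
    rw [Set.union_sdiff_cancel hXY] at this
    omega

/-- If a set is partitioned into finitely many definable pieces, one of them has the same
dimension. -/
lemma _root_.IsMSMeasure.exists_dim_eq (h : IsMSMeasure L dim μ) {n : ℕ} {ι : Type*}
    (V : Finset ι) (X : ι → Set (Fin n → D)) (hX : ∀ i, (Set.univ : Set D).Definable L (X i))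
    (hdisj : Pairwise fun i i' => Disjoint (X i) (X i')) (hne : (⋃ i ∈ V, X i).Nonempty) :
    ∃ i ∈ V, (X i).Nonempty ∧ dim n (⋃ i ∈ V, X i) = dim n (X i) := by
  classical
  induction V using Finset.induction_on with
  | empty => simp at hne
  | insert i V hi ih =>
    rw [Finset.set_biUnion_insert] at hne ⊢
    obtain hi0 | hi0 := Set.eq_empty_or_nonempty (X i)
    · rw [hi0, Set.empty_union] at hne ⊢
      obtain ⟨i', hi', h'⟩ := ih hne
      exact ⟨i', Finset.mem_insert_of_mem hi', h'⟩
    obtain hV | hV := Set.eq_empty_or_nonempty (⋃ i ∈ V, X i)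
    · rw [hV, Set.union_empty]
      exact ⟨i, Finset.mem_insert_self i V, hi0, rfl⟩
    have hd : Disjoint (X i) (⋃ i ∈ V, X i) := by
      simp only [Set.disjoint_iUnion_right]
      exact fun i' hi' => hdisj fun hii => hi (hii ▸ hi')
    have hu := (h.union n _ _ (hX i) (Set.definable_biUnion_finset hX V) hi0 hV hd).1
    obtain ⟨i', hi', hne', heq⟩ := ih hV
    obtain hle | hle := le_total (dim n (⋃ i ∈ V, X i)) (dim n (X i))
    · exact ⟨i, Finset.mem_insert_self i V, hi0, by rw [hu, max_eq_left hle]⟩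
    · exact ⟨i', Finset.mem_insert_of_mem hi', hne', by rw [hu, max_eq_right hle, heq]⟩

/-- In dimension `0` the measure adds up over a finite subset and its complement, so `μ(X)` would
exceed the size of every finite subset of `X`. -/
lemma _root_.IsMSMeasure.dim_pos_of_infinite (h : IsMSMeasure L dim μ) {n : ℕ}
    {X : Set (Fin n → D)} (hX : (Set.univ : Set D).Definable L X) (hinf : X.Infinite) :
    0 < dim n X := by
  rw [Nat.pos_iff_ne_zero]
  intro h0
  obtain ⟨K, hK⟩ := exists_nat_ge (μ n X)
  obtain ⟨F, hFX, hF⟩ := hinf.exists_subset_card_eq (K + 1)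
  have hFne : (F : Set (Fin n → D)).Nonempty := by
    rw [Finset.coe_nonempty, ← Finset.card_pos]
    omega
  have hne : (X \ F).Nonempty := (hinf.sdiff F.finite_toSet).nonempty
  have hdef := hX.sdiff (definable_finset F)
  have hu := h.union n F (X \ F) (definable_finset F) hdef hFne hne Set.disjoint_sdiff_right
  rw [Set.union_sdiff_cancel hFX] at hu
  obtain ⟨hF0, hFμ⟩ := h.of_finite n F hFne F.finite_toSet
  have hμ := hu.2.1 (by omega)
  have hpos := h.pos n _ hdef hne
  rw [Set.ncard_coe_finset, hF] at hFμ
  push_cast at hFμ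
  linarith

lemma _root_.IsMSMeasure.dim_eq_of_infinite (h : IsMSMeasure L dim μ)
    (hD : IsStronglyMinimal L D) {P : Set (Fin 1 → D)}
    (hP : (Set.univ : Set D).Definable L P) (hinf : P.Infinite) :
    dim 1 P = dim 1 Set.univ := by
  obtain hemp | hne := Set.eq_empty_or_nonempty Pᶜ
  · rw [Set.compl_empty_iff.1 hemp]
  · have hfin := (hD.finite_or_finite_compl hP).resolve_left hinf
    have := (h.union 1 P Pᶜ hP hP.compl hinf.nonempty hne disjoint_compl_right).1
    rw [Set.union_compl_self, (h.of_finite 1 _ hne hfin).1] at this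
    simpa using this.symm

/-! ### Fibring over a coordinate -/

lemma definable_preimage_elim {m n : ℕ} {T : Set (Fin m → D)}
    (hT : (Set.univ : Set D).Definable L T) (e : Fin m → D ⊕ Fin n) :
    (Set.univ : Set D).Definable L {b : Fin n → D | Sum.elim id b ∘ e ∈ T} := by
  obtain ⟨θ, rfl⟩ := exists_formulaSet_eq hT
  convert definable_formulaSet (θ.relabel (Sum.elim Sum.inl e)) (id : D → D) using 1
  ext b
  simp only [formulaSet, Set.mem_ofPred_eq, Formula.realize_relabel]
  rw [iff_iff_eq]
  congr 1
  ext (y | y) <;> rfl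

/-- The coordinate functions on a definable set decompose into definable pieces on which the
dimension is additive. -/
lemma _root_.IsMSMeasure.exists_fibration (h : IsMSMeasure L dim μ) {n : ℕ}
    {X : Set (Fin n → D)} (hX : (Set.univ : Set D).Definable L X) (j : Fin n) :
    ∃ (V : Finset (ℕ × ℝ)) (P : ℕ × ℝ → Set (Fin 1 → D)),
      (∀ v, (Set.univ : Set D).Definable L (P v)) ∧
      (∀ b, (slice X j b).Nonempty → ∃ v ∈ V, b ∈ P v) ∧
      (Pairwise fun v v' => Disjoint (P v) (P v')) ∧
      (∀ v, ∀ b ∈ P v, (slice X j b).Nonempty ∧ dim n (slice X j b) = v.1) ∧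
      (∀ v, (Set.univ : Set D).Definable L {x ∈ X | (fun _ => x j) ∈ P v}) ∧
      ∀ v, (P v).Nonempty → dim n {x ∈ X | (fun _ => x j) ∈ P v} = dim 1 (P v) + v.1 := by
  obtain ⟨φ, hφ⟩ := exists_formulaSet_eq hX
  obtain ⟨m, e, φ', hφ'⟩ := exists_formula_fin_left.{u, v, w} (sliceFormula φ j)
  have hs : ∀ b : Fin 1 → D,
      slice X j b = {x | φ'.Realize (Sum.elim (Sum.elim id b ∘ e) x)} := fun b => by
    rw [hφ, ← formulaSet_sliceFormula]
    ext x
    exact (hφ' D _ x).symm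
  -- Pieces are indexed by dimension and measure together, since the fibre axiom requires both to be
  -- constant.
  let P : ℕ × ℝ → Set (Fin 1 → D) := fun v =>
    {b | (slice X j b).Nonempty ∧ dim n (slice X j b) = v.1 ∧ μ n (slice X j b) = v.2}
  have hP : ∀ v, (Set.univ : Set D).Definable L (P v) := fun v => by
    have := definable_preimage_elim
      ((h.definable_values m n φ' v.1 v.2).mono (Set.empty_subset _)) e
    simp only [Set.mem_ofPred_eq, ← hs] at this
    exact this
  have hXP : ∀ v, (Set.univ : Set D).Definable L {x ∈ X | (fun _ => x j) ∈ P v} := fun v =>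
    hX.inter ((hP v).preimage_comp fun _ : Fin 1 => j)
  refine ⟨(h.finite_values m n φ').toFinset, P, hP, fun b hb => ?_, ?_, fun v b hb =>
    ⟨hb.1, hb.2.1⟩, hXP, fun v hv => ?_⟩
  · refine ⟨(dim n (slice X j b), μ n (slice X j b)), ?_, hb, rfl, rfl⟩
    rw [Set.Finite.mem_toFinset]
    refine ⟨Sum.elim id b ∘ e, ?_, ?_⟩
    · rw [← hs]
      exact hb
    · rw [← hs]
  · intro v v' hv
    refine Set.disjoint_left.2 fun b hb hb' => hv (Prod.ext ?_ ?_)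
    · exact hb.2.1.symm.trans hb'.2.1
    · exact hb.2.2.symm.trans hb'.2.2
  · have himage : (fun (x : Fin n → D) (_ : Fin 1) => x j) '' {x ∈ X | (fun _ => x j) ∈ P v} =
        P v := by
      ext b
      constructor
      · rintro ⟨x, hx, rfl⟩
        exact hx.2
      · intro hb
        obtain ⟨x, hx, hxb⟩ := hb.1
        exact ⟨x, ⟨hx, by rw [hxb]; exact hb⟩, hxb⟩
    have hfib : ∀ b ∈ P v, {x ∈ {x ∈ X | (fun _ => x j) ∈ P v} | (fun _ : Fin 1 => x j) = b} =
        slice X j b := by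
      intro b hb
      ext x
      constructor
      · rintro ⟨hx, hxb⟩
        exact ⟨hx.1, hxb⟩
      · rintro ⟨hx, hxb⟩
        exact ⟨⟨hx, by rw [hxb]; exact hb⟩, hxb⟩
    have hne : {x ∈ X | (fun _ => x j) ∈ P v}.Nonempty := by
      rw [← himage] at hv
      exact hv.of_image
    refine (h.fibre n 1 _ (P v) (hXP v) (hP v) hne hv _ himage ?_ v.1 v.2 fun b hb => ?_).1
    · refine ((hXP v).preimage_comp Sum.inl).inter (g := {z : Fin n ⊕ Fin 1 → D |
        (fun _ : Fin 1 => z (Sum.inl j)) = z ∘ Sum.inr}) ?_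
      have := (Set.Definable.diagonal L (Set.univ : Set D)).preimage_comp
        (![Sum.inl j, Sum.inr 0] : Fin 2 → Fin n ⊕ Fin 1)
      convert this using 1
      ext z
      simp [funext_iff]
    · rw [hfib b hb]
      exact hb.2

/-! ### Dimension and large lists -/

/-- Some piece `P v` contains infinitely many `b` with a large slice. The part of `X` over it has
dimension `k + v.1`, where `k = dim D`, and `v.1` is bounded below by induction. -/
lemma _root_.IsMSMeasure.mul_length_le_dim (h : IsMSMeasure L dim μ)
    (hD : IsStronglyMinimal L D) {n : ℕ} (l : List (Fin n)) {X : Set (Fin n → D)}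
    (hX : (Set.univ : Set D).Definable L X) (hl : IsLarge l X) :
    dim 1 Set.univ * l.length ≤ dim n X := by
  induction l generalizing X with
  | nil => simp
  | cons j l ih =>
    obtain ⟨V, P, hP, hV, -, hPd, hXP, hdim⟩ := h.exists_fibration hX j
    have hinf : {b | IsLarge l (slice X j b)}.Infinite := hl
    have hsub : {b | IsLarge l (slice X j b)} ⊆ ⋃ v ∈ V, {b | IsLarge l (slice X j b)} ∩ P v := by
      intro b hb
      obtain ⟨v, hv, hbv⟩ := hV b (IsLarge.nonempty hb)
      exact Set.mem_iUnion₂.2 ⟨v, hv, hb, hbv⟩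
    obtain ⟨v, hv⟩ : ∃ v, ({b | IsLarge l (slice X j b)} ∩ P v).Infinite := by
      by_contra! hfin
      exact (hinf.mono hsub)
        (V.finite_toSet.biUnion fun v _ => hfin v)
    obtain ⟨b, hb, hbv⟩ := hv.nonempty
    have hPinf : (P v).Infinite := hv.mono Set.inter_subset_right
    have h1 := ih (definable_slice hX j b) hb
    have hne : {x ∈ X | (fun _ => x j) ∈ P v}.Nonempty := by
      obtain ⟨x, hx, hxb⟩ := (hPd v b hbv).1
      exact ⟨x, hx, by rw [hxb]; exact hbv⟩
    have h2 := h.dim_mono (hXP v) hX hne (fun x hx => hx.1)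
    rw [hdim v ⟨b, hbv⟩, h.dim_eq_of_infinite hD (hP v) hPinf] at h2
    rw [(hPd v b hbv).2] at h1
    rw [List.length_cons, mul_add, mul_one]
    omega

/-- Induction on the set `J` of coordinates allowed to vary: slicing at `j` freezes that coordinate.
A piece of full dimension lies over some `P v`. If `P v` is finite, one slice already has the
dimension of `X`; if it is infinite, `j` contributes a further `dim D`. -/
lemma _root_.IsMSMeasure.exists_isLarge_dim_eq_of_const (h : IsMSMeasure L dim μ)
    (hD : IsStronglyMinimal L D) {n : ℕ} (J : Finset (Fin n)) {X : Set (Fin n → D)}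
    (hX : (Set.univ : Set D).Definable L X) (hne : X.Nonempty)
    (hJ : ∀ i ∉ J, ∀ x ∈ X, ∀ y ∈ X, x i = y i) :
    ∃ l : List (Fin n), IsLarge l X ∧ dim n X = dim 1 Set.univ * l.length := by
  have := hD.1
  induction J using Finset.induction_on generalizing X with
  | empty =>
    have hsub : X.Subsingleton := fun x hx y hy => by
      ext i
      exact hJ i (by simp) x hx y hy
    exact ⟨[], hne, by simpa using (h.of_finite n X hne hsub.finite).1⟩
  | insert j J _ ih =>
    obtain ⟨V, P, hP, hV, hPdisj, hPd, hXP, hdim⟩ := h.exists_fibration hX j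
    have hunion : X = ⋃ v ∈ V, {x ∈ X | (fun _ => x j) ∈ P v} := by
      ext x
      simp only [Set.mem_iUnion, exists_prop, Set.mem_ofPred_eq]
      constructor
      · intro hx
        obtain ⟨v, hv, hxv⟩ := hV (fun _ => x j) ⟨x, hx, rfl⟩
        exact ⟨v, hv, hx, hxv⟩
      · rintro ⟨v, -, hx, -⟩
        exact hx
    have hslice : ∀ b, (slice X j b).Nonempty → ∃ l : List (Fin n), IsLarge l (slice X j b) ∧
        dim n (slice X j b) = dim 1 Set.univ * l.length := fun b hb => by
      refine ih (definable_slice hX j b) hb fun i hi x hx y hy => ?_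
      obtain rfl | hij := eq_or_ne i j
      · exact congrFun (hx.2.trans hy.2.symm) 0
      · exact hJ i (by simp [hij, hi]) x hx.1 y hy.1
    obtain ⟨v, -, hne', heq⟩ := h.exists_dim_eq V (fun v => {x ∈ X | (fun _ => x j) ∈ P v}) hXP
      (fun v v' hv => Set.disjoint_left.2 fun x hx hx' =>
        Set.disjoint_left.1 (hPdisj hv) hx.2 hx'.2) (hunion ▸ hne)
    rw [← hunion] at heq
    obtain ⟨x, hx, hxv⟩ := hne'
    have hPne : (P v).Nonempty := ⟨_, hxv⟩
    rw [hdim v hPne] at heq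
    obtain hfin | hinf := (P v).finite_or_infinite
    · obtain ⟨l, hl, hdl⟩ := hslice _ (hPd v _ hxv).1
      refine ⟨l, hl.mono (slice_subset _ _ _), ?_⟩
      rw [heq, (h.of_finite 1 _ hPne hfin).1, ← hdl, (hPd v _ hxv).2, zero_add]
    · have hk := h.dim_pos_of_infinite (n := 1) Set.definable_univ Set.infinite_univ
      rw [h.dim_eq_of_infinite hD (hP v) hinf] at heq
      obtain ⟨l₀, -, hl₀⟩ := hslice _ (hPd v _ hxv).1
      rw [(hPd v _ hxv).2] at hl₀
      -- Slices over `P v` have equal dimension, so their lists have equal length because `dim D >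
      -- 0`. Finitely many lists remain, and one is large for infinitely many `b`.
      have hsub : P v ⊆ ⋃ l : {l : List (Fin n) // l.length = l₀.length},
          {b | IsLarge l.1 (slice X j b)} := by
        intro b hb
        obtain ⟨l, hl, hdl⟩ := hslice b (hPd v b hb).1
        rw [(hPd v b hb).2, hl₀] at hdl
        exact Set.mem_iUnion.2 ⟨⟨l, (Nat.eq_of_mul_eq_mul_left hk hdl).symm⟩, hl⟩
      have : Finite {l : List (Fin n) // l.length = l₀.length} :=
        inferInstanceAs (Finite (List.Vector _ _))
      obtain ⟨⟨l, hlen⟩, hl⟩ : ∃ l : {l : List (Fin n) // l.length = l₀.length},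
          {b | IsLarge l.1 (slice X j b)}.Infinite := by
        by_contra! hall
        exact (hinf.mono hsub) (Set.finite_iUnion fun l => hall l)
      refine ⟨j :: l, hl, ?_⟩
      rw [heq, hl₀, List.length_cons, hlen]
      ring

lemma _root_.IsMSMeasure.exists_isLarge_dim_eq (h : IsMSMeasure L dim μ)
    (hD : IsStronglyMinimal L D) {n : ℕ} {X : Set (Fin n → D)}
    (hX : (Set.univ : Set D).Definable L X) (hne : X.Nonempty) :
    ∃ l : List (Fin n), IsLarge l X ∧ dim n X = dim 1 Set.univ * l.length :=
  h.exists_isLarge_dim_eq_of_const hD Finset.univ hX hne (by simp)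

/-! ### Dimension and Morley rank -/

lemma _root_.IsMSMeasure.exists_morleyRank_eq (h : IsMSMeasure L dim μ)
    (hD : IsStronglyMinimal L D) {n : ℕ} {X : Set (Fin n → D)}
    (hX : (Set.univ : Set D).Definable L X) (hne : X.Nonempty) :
    ∃ d : ℕ, morleyRank L X = (((d : Ordinal.{w}) : WithTop Ordinal.{w}) :
      WithBot (WithTop Ordinal.{w})) ∧ dim n X = dim 1 Set.univ * d := by
  have := hD.1
  have hk := h.dim_pos_of_infinite (n := 1) Set.definable_univ Set.infinite_univ
  obtain ⟨l, hl, hdim⟩ := h.exists_isLarge_dim_eq hD hX hne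
  refine ⟨l.length, IsLUB.sSup_eq (IsGreatest.isLUB
    ⟨⟨_, hl.morleyRankGE hX, rfl⟩, ?_⟩), hdim⟩
  rintro _ ⟨α, hα, rfl⟩
  rw [WithBot.coe_le_coe, WithTop.coe_le_coe]
  by_contra! hlt
  -- A rank above `l.length`, infinite or not, would give a large list of length `l.length + 1`,
  -- hence a dimension too big for `X`.
  obtain ⟨l', hlen, hl'⟩ := (h.uniformlyMinimal hD).exists_isLarge_of_morleyRankGE hα
    (ElementaryEmbedding.refl L D).elementarilyEquivalent hX (m := l.length + 1)
    (by rw [Nat.cast_succ]; exact Order.add_one_le_of_lt hlt)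
  have hle := h.mul_length_le_dim hD l' hX hl'
  rw [hdim, hlen] at hle
  exact absurd (Nat.le_of_mul_le_mul_left hle hk) (by omega)

lemma definable_preimage_fibre {n m : ℕ} {X : Set (Fin n → D)} {f : (Fin n → D) → (Fin m → D)}
    (hf : (Set.univ : Set D).Definable L
      {z : Fin n ⊕ Fin m → D | z ∘ Sum.inl ∈ X ∧ f (z ∘ Sum.inl) = z ∘ Sum.inr})
    (b : Fin m → D) : (Set.univ : Set D).Definable L {x ∈ X | f x = b} := by
  obtain ⟨θ, hθ⟩ := Set.definable_iff_exists_formula_sum.1 hf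
  convert definable_formulaSet (θ.relabel (Sum.elim (Sum.inl ∘ Subtype.val)
    (Sum.elim Sum.inr (Sum.inl ∘ b)))) (id : D → D) using 1
  ext x
  have hx := Set.ext_iff.1 hθ (Sum.elim x b)
  simp only [Set.mem_ofPred_eq, Sum.elim_comp_inl, Sum.elim_comp_inr] at hx
  simp only [formulaSet, Set.mem_ofPred_eq, Formula.realize_relabel]
  rw [hx, iff_iff_eq]
  congr 1
  ext (y | y | y) <;> rfl

/-- Rescaling the dimension of an MS-measure. -/
lemma _root_.IsMSMeasure.of_dim_eq_mul (h : IsMSMeasure L dim μ)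
    {rm : ∀ n : ℕ, Set (Fin n → D) → ℕ} {k : ℕ} (hk : 0 < k)
    (hrm : ∀ (n : ℕ) (X : Set (Fin n → D)), (Set.univ : Set D).Definable L X → X.Nonempty →
      dim n X = k * rm n X) : IsMSMeasure L rm μ := by
  have hdef : ∀ {m n : ℕ} (φ : L.Formula (Fin m ⊕ Fin n)) (a : Fin m → D),
      (Set.univ : Set D).Definable L {x : Fin n → D | φ.Realize (Sum.elim a x)} := fun φ a => by
    refine Set.definable_iff_exists_formula_sum.2
      ⟨φ.relabel (Sum.map (fun i => ⟨a i, Set.mem_univ _⟩) id), ?_⟩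
    ext x
    simp only [Set.mem_ofPred_eq, Formula.realize_relabel, Sum.elim_comp_map]
    rfl
  refine ⟨h.pos, fun m n φ => ?_, fun m n φ d r => ?_, fun n X hne hfin => ?_,
    fun n X Y hX hY hXne hYne hXY => ?_, fun n m X Y hX hY hXne hYne f hf hgraph d r hfib => ?_⟩
  -- The division is exact on the values that occur.
  · refine ((h.finite_values m n φ).image fun p => (p.1 / k, p.2)).subset ?_
    rintro _ ⟨a, ha, rfl⟩
    exact ⟨_, ⟨a, ha, rfl⟩, by simp [hrm _ _ (hdef φ a) ha, hk]⟩
  · convert h.definable_values m n φ (k * d) r using 1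
    ext a
    refine and_congr_right fun ha => and_congr_left fun _ => ?_
    rw [hrm _ _ (hdef φ a) ha, Nat.mul_right_inj hk.ne']
  · obtain ⟨h0, hμ⟩ := h.of_finite n X hne hfin
    rw [hrm n X (hfin.coe_toFinset ▸ definable_finset hfin.toFinset) hne] at h0
    exact ⟨(Nat.mul_eq_zero.1 h0).resolve_left hk.ne', hμ⟩
  · have hu := h.union n X Y hX hY hXne hYne hXY
    rw [hrm n X hX hXne, hrm n Y hY hYne, hrm n _ (hX.union hY) hXne.inl, Nat.mul_max_mul_left,
      Nat.mul_right_inj hk.ne', Nat.mul_lt_mul_left hk, Nat.mul_lt_mul_left hk,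
      Nat.mul_right_inj hk.ne'] at hu
    exact hu
  · have hfib' : ∀ b ∈ Y, dim n {x ∈ X | f x = b} = k * d ∧ μ n {x ∈ X | f x = b} = r := by
      intro b hb
      have hb' := hb
      rw [← hf] at hb'
      obtain ⟨x, hx, hxb⟩ := hb'
      have hdefb : (Set.univ : Set D).Definable L {x ∈ X | f x = b} := by
        convert definable_preimage_fibre hgraph b using 1
      exact ⟨by rw [hrm n _ hdefb ⟨x, hx, hxb⟩, (hfib b hb).1], (hfib b hb).2⟩
    have hu := h.fibre n m X Y hX hY hXne hYne f hf hgraph _ r hfib'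
    rw [hrm n X hX hXne, hrm m Y hY hYne, ← mul_add, Nat.mul_right_inj hk.ne'] at hu
    exact hu

end StronglyMinimal

open StronglyMinimal in
theorem lemma2p3 {L : FirstOrder.Language.{u, v}} {D : Type w} [L.Structure D]
    (hD : IsStronglyMinimal L D)
    (dim : ∀ n : ℕ, Set (Fin n → D) → ℕ) (μ : ∀ n : ℕ, Set (Fin n → D) → ℝ)
    (h : IsMSMeasure L dim μ) :
    -- `dim` is a fixed positive multiple of Morley rank, which takes finite values
    (∃ k : ℕ, 0 < k ∧ ∀ (n : ℕ) (X : Set (Fin n → D)),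
      (Set.univ : Set D).Definable L X → X.Nonempty →
      ∃ d : ℕ, morleyRank L X = (((d : Ordinal.{w}) : WithTop Ordinal.{w}) :
        WithBot (WithTop Ordinal.{w})) ∧ dim n X = k * d) ∧
    -- equal dimension is the same as equal Morley rank
    (∀ (n m : ℕ) (X : Set (Fin n → D)) (Y : Set (Fin m → D)),
      (Set.univ : Set D).Definable L X → X.Nonempty →
      (Set.univ : Set D).Definable L Y → Y.Nonempty →
      (dim n X = dim m Y ↔ morleyRank L X = morleyRank L Y)) ∧
    -- MS-measurability is also witnessed by Morley rank together with the same `μ`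
    (∃ rm : ∀ n : ℕ, Set (Fin n → D) → ℕ,
      (∀ (n : ℕ) (X : Set (Fin n → D)), (Set.univ : Set D).Definable L X → X.Nonempty →
        morleyRank L X = (((rm n X : Ordinal.{w}) : WithTop Ordinal.{w}) :
          WithBot (WithTop Ordinal.{w}))) ∧
      IsMSMeasure L rm μ) := by
  have := hD.1
  have hk := h.dim_pos_of_infinite (n := 1) Set.definable_univ Set.infinite_univ
  have key := fun (n : ℕ) (X : Set (Fin n → D)) => h.exists_morleyRank_eq hD (n := n) (X := X)
  refine ⟨⟨dim 1 Set.univ, hk, key⟩, fun n m X Y hX hXne hY hYne => ?_,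
    -- Natural-number division, exact on nonempty definable sets; other values are irrelevant.
    fun n X => dim n X / dim 1 Set.univ, fun n X hX hne => ?_,
    h.of_dim_eq_mul hk fun n X hX hne => ?_⟩
  · obtain ⟨d, hd, hdX⟩ := key n X hX hXne
    obtain ⟨d', hd', hdY⟩ := key m Y hY hYne
    rw [hd, hd', hdX, hdY, Nat.mul_right_inj hk.ne', WithBot.coe_inj, WithTop.coe_inj,
      Nat.cast_inj]
  · obtain ⟨d, hd, hdX⟩ := key n X hX hne
    rw [hd]
    simp only [hdX, Nat.mul_div_cancel_left d hk]
  · obtain ⟨d, -, hdX⟩ := key n X hX hne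
    rw [hdX, Nat.mul_div_cancel_left d hk]
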